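/- Let $B=\bigoplus_{n\ge 0}B_n$ be a graded $\mathbb{C}$-algebra that is an integral domain, with $B_0=\mathbb{C}$, and suppose that $B$ is approximable: every $B_n$ is finite dimensional; $B_n\neq 0$ for all sufficiently large $n$; and for every $\varepsilon>0$ there is a $p_0$ such that for all $p\ge p_0$ $$\liminf_{n\to\infty}\frac{\dim \operatorname{Im}(S^nB_p\to B_{np})}{\dim B_{np}}>1-\varepsilon .$$ Let $K^{\rm gr}(B)=\{f/g : f,g\in B_n \text{ for some } n,\ g\ne 0\}\subset \operatorname{Frac}(B)$ be the field of homogeneous fractions of degree zero. Suppose that $K^{\rm gr}(B)$ is a finitely generated field extension of $\mathbb{C}$ of transcendence degree one, and that there is a non-zero element $b_1\in B_1$ such that the set $$\nu_{B,b_1}=\{\nu \text{ valuation on } K^{\rm gr}(B) \text{ trivial on } \mathbb{C} : \nu(b'/b_1^n)<0 \text{ for some } n\in\mathbb{N} \text{ and } b'\in B_n\},$$ valuations being taken up to equivalence, is infinite. Then there do not exist a complex algebraic variety $X$ (an integral separated scheme of finite type over $\mathbb{C}$) and a big line bundle $L$ on $X$ such that $B$ is isomorphic, as a graded $\mathbb{C}$-algebra,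 to a graded subalgebra of the section ring $R(L)=\bigoplus_{n\ge 0}H^0(X,nL)$. Here $L$ is big if $\limsup_{n\to\infty} d!\,h^0(nL)/n^d>0$, where $d=\dim X$. -/

import Mathlib

open CategoryTheory AlgebraicGeometry TopologicalSpace Filter
open scoped DirectSum ENNReal

noncomputable section

/-! ### Approximable graded algebras -/

/-- An integral graded `ℂ`-algebra `B = ⨁ₙ Bₙ` (integrality is the class `IsDomain B`) is
approximable. The power `(𝓑 p) ^ n` of the subspace `𝓑 p` is the linear span in `B` of all
`n`-fold products of elements of `Bₚ`, that is, the image of `Sⁿ Bₚ → Bₙₚ`. -/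
structure IsApproximable {B : Type*} [CommRing B] [IsDomain B] [Algebra ℂ B]
    (𝓑 : ℕ → Submodule ℂ B) [GradedAlgebra 𝓑] : Prop where
  finiteDimensional : ∀ n, FiniteDimensional ℂ (𝓑 n)
  eventually_ne_bot : ∀ᶠ n in atTop, 𝓑 n ≠ ⊥
  approx : ∀ ε : ℝ, 0 < ε → ∃ p₀ : ℕ, ∀ p ≥ p₀,
    1 - ε < liminf (fun n : ℕ ↦
      (Module.finrank ℂ ↥((𝓑 p) ^ n) : ℝ) / (Module.finrank ℂ ↥(𝓑 (n * p)) : ℝ)) atTop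

/-! ### The graded field of functions -/

section GradedField

variable {B : Type*} [CommRing B] [IsDomain B] [Algebra ℂ B]
  (𝓑 : ℕ → Submodule ℂ B) [GradedAlgebra 𝓑]

/-- The graded field of functions `K^gr(B)`: the fractions `f / g` with `f`, `g` homogeneous of
the same degree, as a subfield of the fraction field of `B`. -/
def gradedFunctionField : IntermediateField ℂ (FractionRing B) where
  carrier := {x | ∃ (n : ℕ) (f g : B), f ∈ 𝓑 n ∧ g ∈ 𝓑 n ∧ g ≠ 0 ∧
    x = algebraMap B (FractionRing B) f / algebraMap B (FractionRing B) g}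
  mul_mem' := by
    rintro _ _ ⟨n, f, g, hf, hg, h0, rfl⟩ ⟨m, f', g', hf', hg', h0', rfl⟩
    refine ⟨n + m, f * f', g * g', SetLike.mul_mem_graded hf hf',
      SetLike.mul_mem_graded hg hg', mul_ne_zero h0 h0', ?_⟩
    rw [map_mul, map_mul, div_mul_div_comm]
  add_mem' := by
    rintro _ _ ⟨n, f, g, hf, hg, h0, rfl⟩ ⟨m, f', g', hf', hg', h0', rfl⟩
    refine ⟨n + m, f * g' + g * f', g * g',
      add_mem (SetLike.mul_mem_graded hf hg') (SetLike.mul_mem_graded hg hf'),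
      SetLike.mul_mem_graded hg hg', mul_ne_zero h0 h0', ?_⟩
    rw [map_add, map_mul, map_mul, map_mul, div_add_div]
    · simpa using h0
    · simpa using h0'
  algebraMap_mem' := by
    intro c
    refine ⟨0, algebraMap ℂ B c, 1, SetLike.algebraMap_mem_graded 𝓑 c,
      SetLike.one_mem_graded 𝓑, one_ne_zero, ?_⟩
    rw [map_one, div_one, ← IsScalarTower.algebraMap_apply]
  inv_mem' := by
    rintro _ ⟨n, f, g, hf, hg, h0, rfl⟩
    by_cases hf0 : f = 0
    · exact ⟨0, 0, 1, zero_mem _, SetLike.one_mem_graded 𝓑, one_ne_zero, by simp [hf0]⟩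
    · exact ⟨n, g, f, hg, hf, hf0, by rw [inv_div]⟩

variable {𝓑}

/-- The element `b / b₁ⁿ` of `K^gr(B)`, for `b ∈ Bₙ` and `0 ≠ b₁ ∈ B₁`. -/
def gradedFraction (b₁ : 𝓑 1) (hb₁ : b₁ ≠ 0) (n : ℕ) (b : 𝓑 n) : gradedFunctionField 𝓑 :=
  ⟨algebraMap B (FractionRing B) b / algebraMap B (FractionRing B) ((b₁ : B) ^ n),
    n, b, (b₁ : B) ^ n, b.2, by simpa using SetLike.pow_mem_graded n b₁.2,
    pow_ne_zero n (by simpa using hb₁), rfl⟩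

/-- The set `ν_{B, b₁}` of valuations of `K^gr(B)` over `ℂ` (that is, trivial on `ℂ`) that are
negative on some `b / b₁ⁿ` with `b ∈ Bₙ`. Valuations are taken up to equivalence, so they are
given by their valuation rings `V`; triviality on `ℂ` means `ℂ ⊆ V`. Mathlib writes valuations
multiplicatively, so the condition `ν(x) < 0` reads `1 < V.valuation x`. -/
def negativeValuations (b₁ : 𝓑 1) (hb₁ : b₁ ≠ 0) :
    Set (ValuationSubring (gradedFunctionField 𝓑)) :=
  {V | (∀ c : ℂ, algebraMap ℂ (gradedFunctionField 𝓑) c ∈ V) ∧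
    ∃ (n : ℕ) (b : 𝓑 n), 1 < V.valuation (gradedFraction b₁ hb₁ n b)}

end GradedField

/-! ### Complex varieties, line bundles and section rings -/

/-- A complex algebraic variety: an integral separated scheme of finite type over `ℂ`. -/
structure ComplexVariety where
  scheme : Scheme.{0}
  str : scheme ⟶ Spec (.of ℂ)
  isIntegral : IsIntegral scheme
  isSeparated : IsSeparated str
  locallyOfFiniteType : LocallyOfFiniteType str
  quasiCompact : QuasiCompact str

namespace ComplexVariety

/-- The restriction map `𝒪(V) → 𝒪(U)` for `U ≤ V`. -/
def res (X : ComplexVariety) {U V : X.scheme.Opens} (h : U ≤ V) :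
    Γ(X.scheme, V) →+* Γ(X.scheme, U) :=
  (X.scheme.presheaf.map (homOfLE h).op).hom

/-- The map `ℂ → 𝒪(U)` given by the structure morphism. -/
def scalars (X : ComplexVariety) (U : X.scheme.Opens) : ℂ →+* Γ(X.scheme, U) :=
  (X.res (le_top : U ≤ ⊤)).comp
    ((Scheme.ΓSpecIso (.of ℂ)).inv ≫ X.str.appTop).hom

instance (X : ComplexVariety) (U : X.scheme.Opens) : Algebra ℂ Γ(X.scheme, U) :=
  (X.scalars U).toAlgebra

theorem res_algebraMap (X : ComplexVariety) {U V : X.scheme.Opens} (h : U ≤ V) (c : ℂ) :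
    X.res h (algebraMap ℂ Γ(X.scheme, V) c) = algebraMap ℂ Γ(X.scheme, U) c := by
  change X.res h (X.res le_top _) = X.res le_top _
  simp only [res]
  rw [← CommRingCat.comp_apply, ← Functor.map_comp]
  rfl

end ComplexVariety

/-- A line bundle on `X`, given by an open cover `(Uᵢ)` over which it is trivial and its
transition functions `gᵢⱼ ∈ 𝒪(Uᵢ ∩ Uⱼ)ˣ`, which satisfy the cocycle condition
`gᵢⱼ gⱼₖ = gᵢₖ` on `Uᵢ ∩ Uⱼ ∩ Uₖ` (hence also `gᵢᵢ = 1` and `gⱼᵢ = gᵢⱼ⁻¹`). -/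
structure LineBundle (X : ComplexVariety) where
  ι : Type
  U : ι → X.scheme.Opens
  iSup_U : ⨆ i, U i = ⊤
  g : ∀ i j, Γ(X.scheme, U i ⊓ U j)ˣ
  cocycle : ∀ i j k,
    X.res (le_inf (inf_le_left.trans inf_le_left) (inf_le_left.trans inf_le_right) :
        U i ⊓ U j ⊓ U k ≤ U i ⊓ U j) (g i j) *
      X.res (le_inf (inf_le_left.trans inf_le_right) inf_le_right :
        U i ⊓ U j ⊓ U k ≤ U j ⊓ U k) (g j k) =
      X.res (le_inf (inf_le_left.trans inf_le_left) inf_le_right :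
        U i ⊓ U j ⊓ U k ≤ U i ⊓ U k) (g i k)

namespace LineBundle

variable {X : ComplexVariety} (L : LineBundle X)

/-- The space `H⁰(X, nL)` of global sections of the `n`-th tensor power of `L` (which has the
transition functions `gᵢⱼⁿ`): families `sᵢ ∈ 𝒪(Uᵢ)` with `sᵢ = gᵢⱼⁿ sⱼ` on `Uᵢ ∩ Uⱼ`. -/
def H0 (n : ℕ) : Submodule ℂ (∀ i, Γ(X.scheme, L.U i)) where
  carrier := {s | ∀ i j, X.res (inf_le_left : L.U i ⊓ L.U j ≤ L.U i) (s i) =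
    (L.g i j : Γ(X.scheme, L.U i ⊓ L.U j)) ^ n *
      X.res (inf_le_right : L.U i ⊓ L.U j ≤ L.U j) (s j)}
  zero_mem' i j := by simp
  add_mem' {s t} hs ht i j := by
    simp only [Pi.add_apply, map_add, hs i j, ht i j, mul_add]
  smul_mem' c s hs i j := by
    simp only [Pi.smul_apply, Algebra.smul_def, map_mul, hs i j, X.res_algebraMap]
    ring

/-- Sections of `nL` and `mL` multiply to sections of `(n + m)L`. -/
instance : SetLike.GradedMonoid L.H0 where
  one_mem i j := by simp
  mul_mem n m s t hs ht i j := by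
    simp only [Pi.mul_apply, map_mul, hs i j, ht i j, pow_add]
    ring

/-- The section ring `R(L) = ⨁ₙ H⁰(X, nL)`. Its ring structure is the one that Mathlib puts on
the direct sum of the pieces `L.H0 n`, from the products of sections above. -/
abbrev SectionRing : Type := ⨁ n, L.H0 n

/-- `h⁰(nL)`, which may be infinite if `X` is not complete. -/
def h0 (n : ℕ) : ℕ∞ := (Module.rank ℂ (L.H0 n)).toENat

/-- `L` is big: `vol(L) = limsup d! h⁰(nL) / n^d` is positive, where `d` is the dimension of `X`. -/
def IsBig : Prop :=
  ∃ d : ℕ, topologicalKrullDim X.scheme = d ∧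
    0 < limsup (fun n : ℕ ↦ (d.factorial : ℝ≥0∞) * (L.h0 n : ℝ≥0∞) / (n : ℝ≥0∞) ^ d) atTop

end LineBundle

end

/-! Inside a section ring, all the fractions `b / b₁ⁿ` lie in one finitely generated algebra, and a
finitely generated algebra allows poles at only finitely many places of a curve.

Trivializing `L` at the generic point embeds `R(L)` in `K(X)[T]`. On an affine open `V` inside the
trivializing open set, a section of `nL` becomes `f Tⁿ` with `f ∈ 𝒪(V)`. So every `b / b₁ⁿ` lies in
`A = 𝒪(V)[T, 1/φ(b₁)]`, which is of finite type over `ℂ`.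

By `ValuationSubring.finite_setOf_exists_notMem`, almost all valuation rings of `K = K^gr(B)` over
`ℂ` contain `A ∩ K`. Indeed, let `D` be the integral closure of `ℂ[t]` in `K`, a Dedekind domain.
The image of `Spec D[A] → Spec D` contains a nonempty basic open set, and a valuation ring centered
at a point of the image contains `A ∩ K`. The exceptions have a fixed `u ≠ 0` in their center, or a
pole at `t`: finitely many in both cases. -/

/-! ### Valuation rings of the fraction field of a Dedekind domain -/

section Dedekind

variable {D K : Type*} [CommRing D] [Field K] [Algebra D K]

/-- The center on `D` of a valuation ring `V` of `K` containing `D`. -/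
def ValuationSubring.center (V : ValuationSubring K) (hV : ∀ d : D, algebraMap D K d ∈ V) :
    Ideal D :=
  (IsLocalRing.maximalIdeal V).comap ((algebraMap D K).codRestrict V hV)

instance ValuationSubring.center_isPrime (V : ValuationSubring K)
    (hV : ∀ d : D, algebraMap D K d ∈ V) : (V.center hV).IsPrime :=
  Ideal.comap_isPrime _ _

theorem ValuationSubring.mem_center_iff {V : ValuationSubring K}
    {hV : ∀ d : D, algebraMap D K d ∈ V} {d : D} :
    d ∈ V.center hV ↔ V.valuation (algebraMap D K d) < 1 := by
  rw [ValuationSubring.center, Ideal.mem_comap]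
  exact V.valuation_lt_one_iff _

variable [IsDedekindDomain D] [IsFractionRing D K]

/-- The localization of a Dedekind domain at a prime is a valuation ring of the fraction field. -/
theorem IsDedekindDomain.exists_mul_eq_or_mul_eq (p : Ideal D) [p.IsPrime] (x : K) :
    ∃ a s : D, s ∉ p ∧
      (x * algebraMap D K s = algebraMap D K a ∨ x * algebraMap D K a = algebraMap D K s) := by
  obtain ⟨a, b, hb, rfl⟩ := IsFractionRing.div_surjective (A := D) x
  have hb0 : algebraMap D K b ≠ 0 := by
    simpa using nonZeroDivisors.ne_zero hb
  -- The localization at `⊥` is a field, not a discrete valuation ring.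
  rcases eq_or_ne p ⊥ with rfl | hp
  · exact ⟨a, b, by simpa using nonZeroDivisors.ne_zero hb, .inl (div_mul_cancel₀ _ hb0)⟩
  have := IsLocalization.AtPrime.isDiscreteValuationRing_of_dedekind_domain D hp
    (Localization.AtPrime p)
  have hinj : Function.Injective (algebraMap D (Localization.AtPrime p)) :=
    IsLocalization.injective _ p.primeCompl_le_nonZeroDivisors
  have key : ∀ a b : D, algebraMap D (Localization.AtPrime p) a ∣ algebraMap D _ b →
      ∃ d s : D, s ∉ p ∧ a * d = b * s := by
    rintro a b ⟨c, hc⟩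
    obtain ⟨d, s, rfl⟩ := IsLocalization.exists_mk'_eq p.primeCompl c
    refine ⟨d, s, s.2, hinj ?_⟩
    rw [map_mul, map_mul, hc, mul_assoc, IsLocalization.mk'_spec]
  rcases ValuationRing.dvd_total (algebraMap D (Localization.AtPrime p) b)
    (algebraMap D (Localization.AtPrime p) a) with h | h
  · obtain ⟨d, s, hs, h⟩ := key _ _ h
    refine ⟨d, s, hs, .inl ?_⟩
    rw [div_mul_eq_mul_div, div_eq_iff hb0, ← map_mul, ← map_mul, ← h, mul_comm]
  · obtain ⟨d, s, hs, h⟩ := key _ _ h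
    refine ⟨d, s, hs, .inr ?_⟩
    rw [div_mul_eq_mul_div, div_eq_iff hb0, ← map_mul, ← map_mul, h, mul_comm]

/-- A valuation ring containing a Dedekind domain with fraction field `K` is the localization at
its center. -/
theorem ValuationSubring.mem_iff_exists_notMem_center {V : ValuationSubring K}
    (hV : ∀ d : D, algebraMap D K d ∈ V) {x : K} :
    x ∈ V ↔ ∃ a s : D, s ∉ V.center hV ∧ x * algebraMap D K s = algebraMap D K a := by
  have hle : ∀ d : D, V.valuation (algebraMap D K d) ≤ 1 :=
    fun d ↦ (V.valuation_le_one_iff _).2 (hV d)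
  have hunit : ∀ s : D, s ∉ V.center hV → V.valuation (algebraMap D K s) = 1 := fun s hs ↦
    le_antisymm (hle s) (not_lt.1 (mt mem_center_iff.2 hs))
  constructor
  · intro hx
    obtain ⟨a, s, hs, h | h⟩ := IsDedekindDomain.exists_mul_eq_or_mul_eq (V.center hV) x
    · exact ⟨a, s, hs, h⟩
    · have hxa : V.valuation x * V.valuation (algebraMap D K a) = 1 := by
        rw [← map_mul, h, hunit s hs]
      have ha : a ∉ V.center hV := fun ha ↦ by
        have := mul_lt_one_of_nonneg_of_lt_one_right ((V.valuation_le_one_iff _).2 hx)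
          zero_le (mem_center_iff.1 ha)
        exact this.ne hxa
      exact ⟨s, a, ha, h⟩
  · rintro ⟨a, s, hs, h⟩
    have hx := hle a
    rwa [← h, map_mul, hunit s hs, mul_one, V.valuation_le_one_iff] at hx

theorem ValuationSubring.eq_of_center_eq {V W : ValuationSubring K}
    (hV : ∀ d : D, algebraMap D K d ∈ V) (hW : ∀ d : D, algebraMap D K d ∈ W)
    (h : V.center hV = W.center hW) : V = W := by
  ext x
  rw [mem_iff_exists_notMem_center hV, mem_iff_exists_notMem_center hW, h]

open Classical in
/-- Only finitely many valuation rings containing `D` have a given nonzero element of `D` as a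
non-unit. -/
theorem ValuationSubring.finite_setOf_valuation_lt_one {u : D} (hu : u ≠ 0) :
    {V : ValuationSubring K | (∀ d : D, algebraMap D K d ∈ V) ∧
      V.valuation (algebraMap D K u) < 1}.Finite := by
  have hfin := Ideal.finite_factors (R := D) (I := Ideal.span {u}) (by simpa using hu)
  -- The center is an injective invariant with values in the primes dividing `(u)`; the default `⊥`
  -- never occurs on this set.
  refine Set.Finite.of_injOn (f := fun V ↦
      if hV : ∀ d : D, algebraMap D K d ∈ V then V.center hV else ⊥) ?_ ?_ (hfin.image
        IsDedekindDomain.HeightOneSpectrum.asIdeal)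
  · rintro V ⟨hV, hVu⟩
    have hmem : u ∈ V.center hV := mem_center_iff.2 hVu
    refine ⟨⟨V.center hV, inferInstance, fun h ↦ hu (by simpa [h] using hmem)⟩, ?_, ?_⟩
    · simpa [Ideal.dvd_iff_le, Ideal.span_singleton_le_iff_mem] using hmem
    · simp [hV]
  · rintro V ⟨hV, -⟩ W ⟨hW, -⟩ h
    simp only [hV, hW, implies_true, dite_true] at h
    exact eq_of_center_eq hV hW h

variable {F : Type*} [Field F] [Algebra K F] [Algebra D F] [IsScalarTower D K F]

/-- Let `A` be a `D`-algebra of finite type inside an extension of `K`. A valuation ring of `K`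
containing `D` contains `A ∩ K`, unless a fixed nonzero element of `D` is a non-unit in it. -/
theorem ValuationSubring.exists_forall_mem_of_finiteType (A : Subalgebra D F)
    [Algebra.FiniteType D A] :
    ∃ u : D, u ≠ 0 ∧ ∀ V : ValuationSubring K, (∀ d : D, algebraMap D K d ∈ V) →
      ¬ V.valuation (algebraMap D K u) < 1 → ∀ x : K, algebraMap K F x ∈ A → x ∈ V := by
  have : FaithfulSMul D F := .trans D K F
  have : FaithfulSMul D A := by
    rw [faithfulSMul_iff_algebraMap_injective]
    exact .of_comp (f := algebraMap A F) (FaithfulSMul.algebraMap_injective D F)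
  have : Algebra.FinitePresentation D A := Algebra.FinitePresentation.of_finiteType.1 inferInstance
  -- Torsion-free over a Dedekind domain means flat, which gives going-down.
  have hopen := PrimeSpectrum.isOpenMap_comap_of_hasGoingDown_of_finitePresentation
    (R := D) (S := A)
  have hinj : Function.Injective (algebraMap D A) := FaithfulSMul.algebraMap_injective D A
  have hbot : (⟨⊥, Ideal.isPrime_bot⟩ : PrimeSpectrum D) ∈
      Set.range (PrimeSpectrum.comap (algebraMap D A)) := by
    refine ⟨⟨⊥, Ideal.isPrime_bot⟩, PrimeSpectrum.ext ?_⟩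
    exact Ideal.comap_bot_of_injective _ hinj
  obtain ⟨_, ⟨u, rfl⟩, hu, hsub⟩ :=
    PrimeSpectrum.isTopologicalBasis_basic_opens.exists_subset_of_mem_open hbot hopen.isOpen_range
  refine ⟨u, by simpa using hu, fun V hV hVu x hx ↦ ?_⟩
  obtain ⟨q, hq⟩ := hsub (a := ⟨V.center hV, inferInstance⟩) (mt mem_center_iff.1 hVu)
  have hq : ∀ d : D, algebraMap D A d ∈ q.asIdeal ↔ d ∈ V.center hV := fun d ↦ by
    rw [← Ideal.mem_comap, ← PrimeSpectrum.comap_asIdeal, hq]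
  obtain ⟨a, s, hs, h | h⟩ := IsDedekindDomain.exists_mul_eq_or_mul_eq (V.center hV) x
  · exact (mem_iff_exists_notMem_center hV).2 ⟨a, s, hs, h⟩
  -- If `a` were in the center, the prime `q` above it would contain `a`, hence `s = x a`, putting
  -- `s` in the center.
  · have ha : a ∉ V.center hV := fun ha ↦ by
      rw [← hq] at ha hs
      refine hs ?_
      have : algebraMap D A s = ⟨algebraMap K F x, hx⟩ * algebraMap D A a := by
        apply Subtype.ext
        change algebraMap D F s = algebraMap K F x * algebraMap D F a
        rw [IsScalarTower.algebraMap_apply D K F, IsScalarTower.algebraMap_apply D K F,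
          ← map_mul, h]
      rw [this]
      exact Ideal.mul_mem_left _ _ ha
    exact (mem_iff_exists_notMem_center hV).2 ⟨s, a, ha, h⟩

end Dedekind

/-! ### Valuation rings of function fields of transcendence degree one -/

section FunctionField

variable {k K : Type*} [Field k] [Field K] [Algebra k K]

/-- Valuation rings are integrally closed. -/
theorem ValuationSubring.algebraMap_integralClosure_mem {V : ValuationSubring K}
    (hV : ∀ c : k, algebraMap k K c ∈ V) {t : K} (ht : t ∈ V)
    (d : integralClosure (Algebra.adjoin k {t}) K) :
    algebraMap (integralClosure (Algebra.adjoin k {t}) K) K d ∈ V := by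
  have hle : ∀ x ∈ Algebra.adjoin k {t}, x ∈ V := fun x hx ↦ by
    induction hx using Algebra.adjoin_induction with
    | mem x hx => rwa [Set.mem_singleton_iff.1 hx]
    | algebraMap c => exact hV c
    | add x y _ _ hx hy => exact V.add_mem _ _ hx hy
    | mul x y _ _ hx hy => exact V.mul_mem _ _ hx hy
  let f : Algebra.adjoin k {t} →+* V := (algebraMap _ K).codRestrict V fun x ↦ hle x x.2
  have hint : IsIntegral V (d : K) := by
    obtain ⟨p, hp, hp0⟩ := d.2
    refine ⟨p.map f, hp.map f, ?_⟩
    rw [Polynomial.eval₂_map]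
    exact hp0
  obtain ⟨y, hy⟩ := IsIntegrallyClosed.isIntegral_iff.1 hint
  change (d : K) ∈ V
  rw [← hy]
  exact y.2

variable [CharZero k]

open IntermediateField.algebraAdjoinAdjoin in
/-- In a function field of one variable, the integral closure of `k[t]` is a Dedekind domain
whose fraction field is the whole field. -/
theorem Transcendental.isDedekindDomain_integralClosure
    (hfg : (⊤ : IntermediateField k K).FG) (htr : Algebra.trdeg k K = 1)
    {t : K} (ht : Transcendental k t) :
    IsDedekindDomain (integralClosure (Algebra.adjoin k {t}) K) ∧
      IsFractionRing (integralClosure (Algebra.adjoin k {t}) K) K := by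
  have hbasis : IsTranscendenceBasis k (fun _ : Unit ↦ t) :=
    AlgebraicIndependent.isTranscendenceBasis_of_lift_trdeg_le_of_finite
      (algebraicIndependent_unique_type_iff.2 ht) (by simp [htr])
  have : Algebra.IsAlgebraic (IntermediateField.adjoin k {t}) K := by
    have := hbasis.isAlgebraic_field
    rwa [Set.range_const] at this
  have : Algebra.EssFiniteType k K := IntermediateField.fg_top_iff.1 hfg
  have : Algebra.EssFiniteType (IntermediateField.adjoin k {t}) K :=
    Algebra.EssFiniteType.of_comp k _ K
  have : FiniteDimensional (IntermediateField.adjoin k {t}) K :=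
    Algebra.finite_of_essFiniteType_of_isAlgebraic
  -- Characteristic zero makes the finite extension `K / k(t)` separable.
  have : CharZero (IntermediateField.adjoin k {t}) := inferInstance
  let e : Polynomial k ≃ₐ[k] Algebra.adjoin k {t} :=
    (AlgEquiv.ofInjective (Polynomial.aeval t) (transcendental_iff_injective.1 ht)).trans
      (Subalgebra.equivOfEq _ _ (Algebra.adjoin_singleton_eq_range_aeval k t).symm)
  have : IsPrincipalIdealRing (Algebra.adjoin k {t}) :=
    IsPrincipalIdealRing.of_surjective e e.surjective
  exact ⟨integralClosure.isDedekindDomain (Algebra.adjoin k {t})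
      (IntermediateField.adjoin k {t}) K,
    integralClosure.isFractionRing_of_finite_extension (IntermediateField.adjoin k {t}) K⟩

/-- Let `K` be a function field of one variable over `k` and `A` a `k`-algebra of finite type
in an extension of `K`. All but finitely many valuation rings of `K` over `k` contain `A ∩ K`. -/
theorem ValuationSubring.finite_setOf_exists_notMem
    (hfg : (⊤ : IntermediateField k K).FG) (htr : Algebra.trdeg k K = 1)
    {F : Type*} [Field F] [Algebra K F] [Algebra k F] [IsScalarTower k K F]
    (A : Subalgebra k F) (hA : A.FG) :
    {V : ValuationSubring K | (∀ c : k, algebraMap k K c ∈ V) ∧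
      ∃ x : K, algebraMap K F x ∈ A ∧ x ∉ V}.Finite := by
  obtain ⟨t, ht⟩ : ∃ t : K, Transcendental k t := by
    by_contra! h
    have : Algebra.IsAlgebraic k K := ⟨fun x ↦ not_not.1 (h x)⟩
    exact zero_ne_one (trdeg_eq_zero.symm.trans htr)
  have ht0 : t ≠ 0 := fun h ↦ ht (h ▸ isAlgebraic_zero)
  have htinv : Transcendental k t⁻¹ := fun h ↦ ht (by simpa using h.inv)
  obtain ⟨S, rfl⟩ := hA
  obtain ⟨hded, hfrac⟩ := ht.isDedekindDomain_integralClosure hfg htr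
  obtain ⟨hded', hfrac'⟩ := htinv.isDedekindDomain_integralClosure hfg htr
  let D := integralClosure (Algebra.adjoin k {t}) K
  let A' : Subalgebra D F := Algebra.adjoin D (S : Set F)
  have : Algebra.FiniteType D A' := (Subalgebra.fg_iff_finiteType _).1 ⟨S, rfl⟩
  obtain ⟨u, hu, hmem⟩ := ValuationSubring.exists_forall_mem_of_finiteType (K := K) A'
  let w : integralClosure (Algebra.adjoin k {t⁻¹}) K :=
    algebraMap (Algebra.adjoin k {t⁻¹}) _ ⟨t⁻¹, Algebra.self_mem_adjoin_singleton k _⟩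
  have hw : w ≠ 0 := fun h ↦ inv_ne_zero ht0 (congr_arg Subtype.val h)
  refine ((ValuationSubring.finite_setOf_valuation_lt_one (K := K) hu).union
    (ValuationSubring.finite_setOf_valuation_lt_one (K := K) hw)).subset ?_
  rintro V ⟨hV, x, hxA, hxV⟩
  -- The two charts of the projective line: `V` lies over the `t`-chart or over the point `t = ∞`,
  -- where `t⁻¹` is a non-unit.
  by_cases htV : t ∈ V
  · have hD := V.algebraMap_integralClosure_mem hV htV
    refine .inl ⟨hD, ?_⟩
    by_contra hlt
    refine hxV (hmem V hD hlt x ?_)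
    refine Algebra.adjoin_induction (p := fun y _ ↦ y ∈ A') (fun y hy ↦ Algebra.subset_adjoin hy)
      (fun c ↦ ?_) (fun _ _ _ _ ↦ A'.add_mem) (fun _ _ _ _ ↦ A'.mul_mem) hxA
    have : algebraMap k F c = algebraMap D F (algebraMap k D c) := by
      rw [IsScalarTower.algebraMap_apply k K F]
      rfl
    rw [this]
    exact A'.algebraMap_mem _
  · have hlt : V.valuation t⁻¹ < 1 := by
      rw [map_inv₀]
      refine inv_lt_one_of_one_lt₀ (not_le.1 fun h ↦ htV ((V.valuation_le_one_iff t).1 h))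
    exact .inr ⟨V.algebraMap_integralClosure_mem hV ((V.valuation_le_one_iff _).1 hlt.le), hlt⟩

end FunctionField

noncomputable section

/-! ### Sections of line bundles as rational functions -/

namespace ComplexVariety

variable (X : ComplexVariety)

instance : IsIntegral X.scheme := X.isIntegral

instance : LocallyOfFiniteType X.str := X.locallyOfFiniteType

theorem finiteType_of_isAffineOpen {V : X.scheme.Opens} (hV : IsAffineOpen V) :
    Algebra.FiniteType ℂ Γ(X.scheme, V) := by
  have h := X.str.finiteType_appLE (isAffineOpen_top (Spec (.of ℂ))) hV le_top
  have hs : Function.Surjective (Scheme.ΓSpecIso (.of ℂ)).inv.hom :=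
    (ConcreteCategory.bijective_of_isIso (Scheme.ΓSpecIso (.of ℂ)).inv).surjective
  exact h.comp (RingHom.FiniteType.of_surjective _ hs)

/-- The germ at the generic point of a function on an open set. -/
def germ {U : X.scheme.Opens} (hU : genericPoint X.scheme ∈ U) :
    Γ(X.scheme, U) →+* X.scheme.functionField :=
  (X.scheme.presheaf.germ U (genericPoint X.scheme) hU).hom

theorem germ_injective {U : X.scheme.Opens} (hU : genericPoint X.scheme ∈ U) :
    Function.Injective (X.germ hU) :=
  germ_injective_of_isIntegral _ _ _

theorem germ_res {U V : X.scheme.Opens} (hU : genericPoint X.scheme ∈ U) (h : U ≤ V)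
    (f : Γ(X.scheme, V)) : X.germ hU (X.res h f) = X.germ (h hU) f :=
  X.scheme.presheaf.germ_res_apply (homOfLE h) _ hU f

theorem genericPoint_mem {U : X.scheme.Opens} {x : X.scheme} (hx : x ∈ U) :
    genericPoint X.scheme ∈ U :=
  ((genericPoint_spec X.scheme).mem_open_set_iff U.isOpen).2 ⟨x, by simpa using hx⟩

end ComplexVariety

namespace LineBundle

variable {X : ComplexVariety} (L : LineBundle X)

/-- A section of `nL` that vanishes generically in one trivialization is zero. -/
theorem eq_zero_of_germ_eq_zero {i : L.ι} (hi : genericPoint X.scheme ∈ L.U i) {n : ℕ}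
    {s : L.H0 n} (hs : X.germ hi (s.1 i) = 0) : s = 0 := by
  have hsi : s.1 i = 0 := X.germ_injective hi (by rw [hs, map_zero])
  refine Subtype.ext (funext fun j ↦ ?_)
  by_cases hj : genericPoint X.scheme ∈ L.U j
  · have hij : genericPoint X.scheme ∈ L.U i ⊓ L.U j := ⟨hi, hj⟩
    have h := congr_arg (X.germ hij) (s.2 i j)
    rw [hsi, map_zero, map_zero, map_mul, map_pow, X.germ_res] at h
    have hg : X.germ hij (L.g i j : Γ(X.scheme, L.U i ⊓ L.U j)) ≠ 0 :=
      ((L.g i j).isUnit.map (X.germ hij)).ne_zero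
    refine X.germ_injective hj ?_
    rw [(mul_eq_zero.1 h.symm).resolve_left (pow_ne_zero n hg)]
    exact (map_zero _).symm
  -- A nonempty open set contains the generic point; over the empty set the ring of functions is
  -- zero.
  · have hbot : L.U j = ⊥ := by
      refine le_bot_iff.1 fun x hx ↦ (hj (X.genericPoint_mem hx)).elim
    have : Subsingleton Γ(X.scheme, L.U j) := by
      rw [hbot]
      infer_instance
    exact Subsingleton.elim _ _

/-- The map from the section ring to polynomials over the function field that sends a section
`s` of `nL` to `s Tⁿ`, in a fixed trivialization. -/
def toPolynomial {i : L.ι} (hi : genericPoint X.scheme ∈ L.U i) :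
    L.SectionRing →+* Polynomial X.scheme.functionField :=
  DirectSum.toSemiring
    (fun n ↦ (Polynomial.monomial n).toAddMonoidHom.comp ((X.germ hi).toAddMonoidHom.comp
      ((Pi.evalAddMonoidHom _ i).comp (L.H0 n).subtype.toAddMonoidHom)))
    (by
      change Polynomial.monomial 0 (X.germ hi 1) = 1
      simp)
    (fun {n m} s t ↦ by
      change Polynomial.monomial (n + m) (X.germ hi (s.1 i * t.1 i)) =
        Polynomial.monomial n (X.germ hi (s.1 i)) * Polynomial.monomial m (X.germ hi (t.1 i))
      rw [map_mul, Polynomial.monomial_mul_monomial])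

variable {i : L.ι} (hi : genericPoint X.scheme ∈ L.U i)

theorem toPolynomial_of (n : ℕ) (s : L.H0 n) :
    L.toPolynomial hi (DirectSum.of (fun k ↦ L.H0 k) n s) =
      Polynomial.monomial n (X.germ hi (s.1 i)) :=
  DirectSum.toSemiring_of _ _ _ _ _

theorem coeff_toPolynomial (x : L.SectionRing) (n : ℕ) :
    (L.toPolynomial hi x).coeff n = X.germ hi ((x n).1 i) := by
  induction x using DirectSum.induction_on with
  | zero => simp
  | of m s =>
    rw [toPolynomial_of, Polynomial.coeff_monomial]
    split_ifs with h
    · subst h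
      rw [DirectSum.of_eq_same]
    · rw [DirectSum.of_eq_of_ne _ _ _ (Ne.symm h)]
      simp
  | add x y hx hy => simp [hx, hy]

theorem toPolynomial_injective : Function.Injective (L.toPolynomial hi) := by
  refine (injective_iff_map_eq_zero _).2 fun x hx ↦ DFinsupp.ext fun n ↦ ?_
  refine L.eq_zero_of_germ_eq_zero hi ?_
  rw [← coeff_toPolynomial, hx, Polynomial.coeff_zero]

theorem toPolynomial_algebraMap (c : ℂ) :
    L.toPolynomial hi (algebraMap ℂ L.SectionRing c) =
      Polynomial.C (X.germ hi (algebraMap ℂ _ c)) := by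
  rw [DirectSum.algebraMap_apply, toPolynomial_of, Polynomial.monomial_zero_left]
  congr 2

end LineBundle

end

/-! ### Homogeneous fractions inside a finitely generated algebra -/

theorem proposition2p2 {B : Type*} [CommRing B] [IsDomain B] [Algebra ℂ B]
    (𝓑 : ℕ → Submodule ℂ B) [GradedAlgebra 𝓑]
    (happ : IsApproximable 𝓑)
    (hB0 : 𝓑 0 = LinearMap.range (Algebra.linearMap ℂ B))
    (hfg : (⊤ : IntermediateField ℂ (gradedFunctionField 𝓑)).FG)
    (htr : Algebra.trdeg ℂ (gradedFunctionField 𝓑) = 1)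
    (b₁ : 𝓑 1) (hb₁ : b₁ ≠ 0)
    (hinf : (negativeValuations b₁ hb₁).Infinite) :
    ¬ ∃ (X : ComplexVariety) (L : LineBundle X), L.IsBig ∧
      ∃ φ : B →ₐ[ℂ] L.SectionRing, Function.Injective φ ∧
        ∀ (n : ℕ) (b : 𝓑 n), ∃ s : L.H0 n, φ b = DirectSum.of (fun k ↦ L.H0 k) n s := by
  rintro ⟨X, L, -, φ, hφ, hgr⟩
  obtain ⟨i, hi⟩ : ∃ i, genericPoint X.scheme ∈ L.U i := by
    rw [← Opens.mem_iSup, L.iSup_U]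
    trivial
  -- Shrinking to an affine open set makes the ring of functions finitely generated.
  obtain ⟨V, hV, hξV, hsub⟩ := exists_isAffineOpen_mem_and_subset hi
  have hVU : V ≤ L.U i := hsub
  have hVft := X.finiteType_of_isAffineOpen hV
  let Ψ : B →+* Polynomial X.scheme.functionField :=
    (L.toPolynomial hi).comp (φ : B →+* L.SectionRing)
  have hΨ : Function.Injective Ψ := (L.toPolynomial_injective hi).comp hφ
  let F := FractionRing (Polynomial X.scheme.functionField)
  let ι : Polynomial X.scheme.functionField →+* F := algebraMap _ F
  let ψ : FractionRing B →+* F := IsFractionRing.map hΨ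
  have hψ : ∀ b, ψ (algebraMap B _ b) = ι (Ψ b) := fun b ↦ IsLocalization.map_eq _ b
  let κ : gradedFunctionField 𝓑 →+* F := ψ.comp (algebraMap _ (FractionRing B))
  let : Algebra (gradedFunctionField 𝓑) F := κ.toAlgebra
  -- Scalars act through `K^gr(B)`; that they agree with the scalars of `X` is `commutes'` below,
  -- from the `ℂ`-linearity of `φ`.
  let : Algebra ℂ F := (κ.comp (algebraMap ℂ _)).toAlgebra
  have : IsScalarTower ℂ (gradedFunctionField 𝓑) F := .of_algebraMap_eq fun _ ↦ rfl
  let θ : Γ(X.scheme, V) →ₐ[ℂ] F :=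
    { (ι.comp Polynomial.C).comp (X.germ hξV) with
      commutes' c := by
        change ι (Polynomial.C (X.germ hξV (algebraMap ℂ _ c))) =
          ψ (algebraMap ℂ (FractionRing B) c)
        rw [IsScalarTower.algebraMap_apply ℂ B (FractionRing B), hψ]
        change _ = ι (L.toPolynomial hi (φ (algebraMap ℂ B c)))
        rw [φ.commutes, L.toPolynomial_algebraMap, ← X.res_algebraMap hVU, X.germ_res] }
  -- The generators do not depend on `n`: only the powers of `T` and `1/φ(b₁)` grow.
  let A : Subalgebra ℂ F := θ.range ⊔ Algebra.adjoin ℂ {ι Polynomial.X, (ι (Ψ b₁))⁻¹}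
  have hθ : θ.range.FG := by
    rw [← Algebra.map_top]
    exact hVft.out.map θ
  have hA : A.FG := hθ.sup
    (Subalgebra.fg_def.2 ⟨_, Set.toFinite _, rfl⟩)
  have hmem : ∀ (n : ℕ) (b : 𝓑 n),
      algebraMap _ F (gradedFraction b₁ hb₁ n b) ∈ A := by
    intro n b
    obtain ⟨s, hs⟩ := hgr n b
    have hval : algebraMap _ F (gradedFraction b₁ hb₁ n b) =
        θ (X.res hVU (s.1 i)) * ι Polynomial.X ^ n * (ι (Ψ b₁))⁻¹ ^ n := by
      change ψ (algebraMap B (FractionRing B) b / algebraMap B (FractionRing B) ((b₁ : B) ^ n)) =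
        ι (Polynomial.C (X.germ hξV (X.res hVU (s.1 i)))) * _ * _
      rw [map_div₀, hψ, hψ, map_pow, map_pow, inv_pow, ← div_eq_mul_inv, X.germ_res,
        ← map_pow ι Polynomial.X, ← map_mul, Polynomial.C_mul_X_pow_eq_monomial,
        ← L.toPolynomial_of, ← hs]
      rfl
    rw [hval]
    have hadj := le_sup_right (a := θ.range) (b := Algebra.adjoin ℂ {ι Polynomial.X, (ι (Ψ b₁))⁻¹})
    exact A.mul_mem (A.mul_mem (le_sup_left (a := θ.range) ⟨_, rfl⟩)
      (A.pow_mem (hadj (Algebra.subset_adjoin (by simp))) n))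
      (A.pow_mem (hadj (Algebra.subset_adjoin (by simp))) n)
  refine hinf ((ValuationSubring.finite_setOf_exists_notMem hfg htr A hA).subset ?_)
  rintro W ⟨hW, n, b, hb⟩
  exact ⟨hW, _, hmem n b, fun h ↦ hb.not_ge ((W.valuation_le_one_iff _).2 h)⟩
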